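/- Let $(T,\Sigma,\mu)$ be a non-atomic, $\sigma$-finite measure space, and let $\Phi\colon T\times[0,\infty]\to[0,\infty]$ be an arbitrary Musielak--Orlicz function: $\Phi(\cdot,u)$ is measurable for every finite $u\ge 0$, and for $\mu$-a.e. $t$ the function $\Phi(t,\cdot)$ is convex and lower semicontinuous on $[0,\infty]$ with $\Phi(t,0)=\lim_{u\downarrow 0}\Phi(t,u)=0$ and $\Phi(t,\infty)=\infty$ (the value $\infty$ is allowed also at finite $u$). Let $\Phi^*(t,v)=\sup_{u>0}(uv-\Phi(t,u))$ and $I_\Phi(u)=\int_T\Phi(t,|u(t)|)\,d\mu$. Let $L^\Phi$ be the space of all real measurable functions $u$ on $T$ (modulo equality $\mu$-a.e.) with $I_\Phi(\lambda u)<\infty$ for some $\lambda>0$, equipped with the Luxemburg norm $\|u\|_\Phi=\inf\{\lambda>0: I_\Phi(u/\lambda)\le 1\}$, and let $L^{\Phi^*}$ be defined in the same way from $\Phi^*$. For $f$ in the topological dual $(L^\Phi)^*$ put $$\|f\|_0=\sup_{u\in L^\Phi}\frac{|f(u)|}{\|u\|_\Phi},$$ with the convention $0/0=0$ at $u=0$.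 A functional in $(L^\Phi)^*$ is called order continuous if it has the form $u\mapsto\int_T uv\,d\mu$ with $v\in L^{\Phi^*}$, and purely singular if it is disjoint, in the Banach lattice $(L^\Phi)^*$, from every order continuous functional. Let $f\in(L^\Phi)^*$, and let $f=f_{\mathrm c}+f_{\mathrm s}$ be its decomposition into an order continuous component $f_{\mathrm c}\in(L^\Phi)^*$ and a purely singular component $f_{\mathrm s}\in(L^\Phi)^*$. Then $$\|f\|_0=\|f_{\mathrm c}\|_0+\|f_{\mathrm s}\|_0.$$ -/

import Mathlib

open MeasureTheory Filter Topology
open scoped ENNReal NNReal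

namespace MusielakOrlicz

/-- A measure is non-atomic if every measurable set of positive measure splits into two
measurable parts of positive measure, that is, if there are no atoms. -/
def IsNonatomic {T : Type*} [MeasurableSpace T] (μ : Measure T) : Prop :=
  ∀ A : Set T, MeasurableSet A → 0 < μ A →
    ∃ B : Set T, MeasurableSet B ∧ B ⊆ A ∧ 0 < μ B ∧ 0 < μ (A \ B)

/-- Musielak--Orlicz functions `Φ : T × [0,∞] → [0,∞]`. Convexity and lower semicontinuity are
required on all of `[0,∞]`. -/
structure MOFun {T : Type*} [MeasurableSpace T] (μ : Measure T) where
  toFun : T → ℝ≥0∞ → ℝ≥0∞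
  convex : ∀ᵐ t ∂μ, ConvexOn ℝ≥0 Set.univ (toFun t)
  lsc : ∀ᵐ t ∂μ, LowerSemicontinuous (toFun t)
  map_zero : ∀ᵐ t ∂μ, toFun t 0 = 0
  tendsto_zero : ∀ᵐ t ∂μ, Tendsto (toFun t) (𝓝[>] 0) (𝓝 0)
  map_top : ∀ᵐ t ∂μ, toFun t ∞ = ∞
  measurable : ∀ u : ℝ≥0, Measurable fun t => toFun t u

/-- The complementary function `Φ*(t,v) = sup_{u>0} (u v - Φ(t,u))`. Subtraction in `[0,∞]` is
truncated at `0`, which does not change the supremum, as `Φ(t,u) → 0` for `u ↓ 0`. -/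
noncomputable def conj {T : Type*} (Φ : T → ℝ≥0∞ → ℝ≥0∞) (t : T) (v : ℝ≥0∞) : ℝ≥0∞ :=
  ⨆ (u : ℝ≥0∞) (_ : 0 < u), (u * v - Φ t u)

section

variable {T : Type*} [MeasurableSpace T] {μ : Measure T}

/-- `I_Φ(u) = ∫ Φ(t,|u(t)|) dμ`. -/
noncomputable def modular (Φ : T → ℝ≥0∞ → ℝ≥0∞) (u : T →ₘ[μ] ℝ) : ℝ≥0∞ :=
  ∫⁻ t, Φ t ‖u t‖ₑ ∂μ

/-- `u ∈ L^Φ`, that is, `I_Φ(c u) < ∞` for some `c > 0`. -/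
def MemMO (Φ : T → ℝ≥0∞ → ℝ≥0∞) (u : T →ₘ[μ] ℝ) : Prop :=
  ∃ c : ℝ, 0 < c ∧ modular Φ (c • u) < ∞

/-- The Luxemburg norm `inf {r > 0 : I_Φ(u / r) ≤ 1}`. -/
noncomputable def luxNorm (Φ : T → ℝ≥0∞ → ℝ≥0∞) (u : T →ₘ[μ] ℝ) : ℝ :=
  sInf {r : ℝ | 0 < r ∧ modular Φ (r⁻¹ • u) ≤ 1}

theorem MOFun.smul_le (Φ : MOFun μ) :
    ∀ᵐ t ∂μ, ∀ (a : ℝ≥0) (x : ℝ≥0∞), a ≤ 1 → Φ.toFun t (a * x) ≤ a * Φ.toFun t x := by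
  filter_upwards [Φ.convex, Φ.map_zero] with t hc h0 a x ha
  have h := hc.2 (Set.mem_univ x) (Set.mem_univ 0) (zero_le : 0 ≤ a)
    (zero_le : 0 ≤ 1 - a) (add_tsub_cancel_of_le ha)
  simpa [h0, ENNReal.smul_def, smul_eq_mul] using h

theorem MOFun.mono (Φ : MOFun μ) : ∀ᵐ t ∂μ, Monotone (Φ.toFun t) := by
  filter_upwards [Φ.smul_le, Φ.map_top, Φ.map_zero] with t hs ht h0 x y hxy
  rcases eq_or_ne y ∞ with rfl | hy
  · rw [ht]; exact le_top
  rcases eq_or_ne y 0 with rfl | hy0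
  · rw [le_antisymm hxy zero_le]
  have hq : x / y ≤ 1 := ENNReal.div_le_of_le_mul (by simpa using hxy)
  have hq' : x / y ≠ ∞ := ne_top_of_le_ne_top ENNReal.one_ne_top hq
  have hx : x = ((x / y).toNNReal : ℝ≥0∞) * y := by
    rw [ENNReal.coe_toNNReal hq', ENNReal.div_mul_cancel hy0 hy]
  have h1 : (x / y).toNNReal ≤ 1 := by
    rw [← ENNReal.coe_le_coe, ENNReal.coe_toNNReal hq']; simpa using hq
  calc Φ.toFun t x = Φ.toFun t ((x / y).toNNReal * y) := by rw [← hx]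
    _ ≤ (x / y).toNNReal * Φ.toFun t y := hs _ _ h1
    _ ≤ 1 * Φ.toFun t y := by gcongr; exact_mod_cast h1
    _ = Φ.toFun t y := one_mul _

/-- The Musielak--Orlicz space `L^Φ`, as a vector subspace of `L⁰`. -/
noncomputable def space (Φ : MOFun μ) : Submodule ℝ (T →ₘ[μ] ℝ) where
  carrier := {u | MemMO Φ.toFun u}
  zero_mem' := by
    refine ⟨1, one_pos, ?_⟩
    have : modular Φ.toFun ((1 : ℝ) • (0 : T →ₘ[μ] ℝ)) = 0 := by
      rw [smul_zero]
      refine (lintegral_congr_ae ?_).trans lintegral_zero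
      filter_upwards [Φ.map_zero, AEEqFun.coeFn_zero (α := T) (β := ℝ) (μ := μ)] with t h0 hz
      simp [hz, h0]
    rw [this]; exact ENNReal.zero_lt_top
  smul_mem' := by
    rintro a u ⟨c, hc, hu⟩
    refine ⟨c / (|a| + 1), by positivity, lt_of_le_of_lt (lintegral_mono_ae ?_) hu⟩
    filter_upwards [Φ.mono, AEEqFun.coeFn_smul (c / (|a| + 1)) (a • u), AEEqFun.coeFn_smul a u,
      AEEqFun.coeFn_smul c u] with t hm h1 h2 h3
    apply hm
    rw [h1, h3, Pi.smul_apply, Pi.smul_apply, h2, Pi.smul_apply]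
    simp only [smul_eq_mul]
    rw [enorm_le_iff_norm_le, norm_mul, norm_mul, norm_mul, ← mul_assoc]
    gcongr
    simp only [Real.norm_eq_abs, abs_div, abs_of_pos hc]
    rw [abs_of_pos (show (0 : ℝ) < |a| + 1 by positivity), div_mul_eq_mul_div,
      div_le_iff₀ (by positivity)]
    nlinarith [abs_nonneg a]
  add_mem' := by
    rintro u v ⟨c, hc, hu⟩ ⟨d, hd, hv⟩
    set e := min c d / 2 with he
    have hep : 0 < e := by positivity
    refine ⟨e, hep, ?_⟩
    have hle : ∀ᵐ t ∂μ, Φ.toFun t ‖(e • (u + v)) t‖ₑ ≤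
        max (Φ.toFun t ‖(c • u) t‖ₑ) (Φ.toFun t ‖(d • v) t‖ₑ) := by
      filter_upwards [Φ.mono, AEEqFun.coeFn_smul e (u + v), AEEqFun.coeFn_add u v,
        AEEqFun.coeFn_smul c u, AEEqFun.coeFn_smul d v] with t hm h1 h2 h3 h4
      rw [← hm.map_max]
      apply hm
      rw [h1, h3, h4, Pi.smul_apply, Pi.smul_apply, Pi.smul_apply, h2, Pi.add_apply]
      simp only [smul_eq_mul]
      rw [le_max_iff, enorm_le_iff_norm_le, enorm_le_iff_norm_le]
      simp only [Real.norm_eq_abs, abs_mul, abs_of_pos hc, abs_of_pos hd, abs_of_pos hep]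
      by_contra! hcon
      have k1 : e ≤ c / 2 := by rw [he]; linarith [min_le_left c d]
      have k2 : e ≤ d / 2 := by rw [he]; linarith [min_le_right c d]
      nlinarith [abs_add_le (u t) (v t), abs_nonneg (u t), abs_nonneg (v t),
        mul_le_mul_of_nonneg_right k1 (abs_nonneg (u t)),
        mul_le_mul_of_nonneg_right k2 (abs_nonneg (v t)),
        mul_le_mul_of_nonneg_left (abs_add_le (u t) (v t)) hep.le]
    -- split the integral at a measurable set where `c |u|` dominates `d |v|`
    set A : Set T := {t | ‖(d • v) t‖ₑ ≤ ‖(c • u) t‖ₑ} with hA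
    have hAm : MeasurableSet A :=
      measurableSet_le (AEEqFun.measurable _).enorm (AEEqFun.measurable _).enorm
    have hbound : modular Φ.toFun (e • (u + v)) ≤
        modular Φ.toFun (c • u) + modular Φ.toFun (d • v) := by
      unfold modular
      rw [← lintegral_add_compl (fun t => Φ.toFun t ‖(e • (u + v)) t‖ₑ) hAm]
      refine add_le_add ?_ ?_
      · refine le_trans (lintegral_mono_ae ?_) (setLIntegral_le_lintegral A _)
        filter_upwards [ae_restrict_of_ae hle, ae_restrict_of_ae Φ.mono,
          ae_restrict_mem hAm] with t h hm ht
        exact h.trans (max_le le_rfl (hm ht))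
      · refine le_trans (lintegral_mono_ae ?_) (setLIntegral_le_lintegral Aᶜ _)
        filter_upwards [ae_restrict_of_ae hle, ae_restrict_of_ae Φ.mono,
          ae_restrict_mem hAm.compl] with t h hm ht
        exact h.trans (max_le (hm (le_of_lt (not_le.mp ht))) le_rfl)
    exact lt_of_le_of_lt hbound (ENNReal.add_lt_top.mpr ⟨hu, hv⟩)

/-- The topological dual `(L^Φ)*`: the linear functionals that are bounded with respect to the
Luxemburg norm. -/
noncomputable def dual (Φ : MOFun μ) : Submodule ℝ (space Φ →ₗ[ℝ] ℝ) where
  carrier := {f | ∃ C : ℝ, ∀ u : space Φ, |f u| ≤ C * luxNorm Φ.toFun (u : T →ₘ[μ] ℝ)}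
  zero_mem' := ⟨0, fun u => by simp⟩
  add_mem' := by
    rintro f g ⟨C, hC⟩ ⟨D, hD⟩
    refine ⟨C + D, fun u => ?_⟩
    rw [LinearMap.add_apply, add_mul]
    exact (abs_add_le _ _).trans (add_le_add (hC u) (hD u))
  smul_mem' := by
    rintro a f ⟨C, hC⟩
    refine ⟨|a| * C, fun u => ?_⟩
    rw [LinearMap.smul_apply, smul_eq_mul, abs_mul, mul_assoc]
    exact mul_le_mul_of_nonneg_left (hC u) (abs_nonneg a)

/-- The norm `‖f‖₀ = sup_u |f(u)| / ‖u‖_Φ` dual to the Luxemburg norm. -/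
noncomputable def dualNorm {Φ : MOFun μ} (f : dual Φ) : ℝ :=
  ⨆ u : space Φ, |f.1 u| / luxNorm Φ.toFun (u : T →ₘ[μ] ℝ)

/-- Order continuous functionals: those of the form `f(u) = ∫ u v dμ` with `v ∈ L^{Φ*}`. -/
def IsOrderContinuous {Φ : MOFun μ} (f : dual Φ) : Prop :=
  ∃ v : T →ₘ[μ] ℝ, MemMO (conj Φ.toFun) v ∧
    ∀ u : space Φ, f.1 u = ∫ t, (u : T →ₘ[μ] ℝ) t * v t ∂μ

/-- The modulus `|f|` in the Banach lattice `(L^Φ)*`, evaluated at a function `u ≥ 0`: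
`|f|(u) = sup {|f(w)| : |w| ≤ u}`. -/
noncomputable def modulus {Φ : MOFun μ} (f : dual Φ) (u : space Φ) : ℝ :=
  sSup {r : ℝ | ∃ w : space Φ, |(w : T →ₘ[μ] ℝ)| ≤ (u : T →ₘ[μ] ℝ) ∧ r = |f.1 w|}

/-- Lattice disjointness `|f| ∧ |g| = 0` in `(L^Φ)*`: for every `u ≥ 0`,
`(|f| ∧ |g|)(u) = inf {|f|(w) + |g|(u - w) : 0 ≤ w ≤ u} = 0`. -/
def AreDisjoint {Φ : MOFun μ} (f g : dual Φ) : Prop :=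
  ∀ u : space Φ, 0 ≤ (u : T →ₘ[μ] ℝ) →
    sInf {r : ℝ | ∃ w : space Φ, 0 ≤ (w : T →ₘ[μ] ℝ) ∧
      (w : T →ₘ[μ] ℝ) ≤ (u : T →ₘ[μ] ℝ) ∧ r = modulus f w + modulus g (u - w)} = 0

/-- Purely singular functionals: those disjoint from all order continuous functionals. -/
def IsPurelySingular {Φ : MOFun μ} (f : dual Φ) : Prop :=
  ∀ g : dual Φ, IsOrderContinuous g → AreDisjoint f g

/-- `fc` and `fs` are the order continuous and the singular component of `f`. -/
structure IsDecomposition {Φ : MOFun μ} (f fc fs : dual Φ) : Prop where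
  eq_add : f = fc + fs
  orderContinuous : IsOrderContinuous fc
  singular : IsPurelySingular fs

end

end MusielakOrlicz

namespace MusielakOrlicz

section

variable {T : Type*} [MeasurableSpace T] {μ : Measure T}

/-! The inequality `≤` is the triangle inequality. For `≥`, the point is that a purely singular
functional lives on sets that are negligible for the modular and for `fc`. Given `u` with `I_Φ(u) <
1` and `w` of finite modular, there are sets `E n`, eventually avoiding almost every point of the
supports of `u` and `w`, such that `fs` almost vanishes on the parts of `u` and `w` outside `E n`
(`IsPurelySingular.exists_sets`). Glue `u` off `E n` to `w` on `E n`. By dominated convergence the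
glued function eventually has modular at most 1, its value under `fc` tends to `fc u`, and its value
under `fs` tends to `fs w`. Hence `fc u + fs w ≤ ‖fc + fs‖₀` (`add_le_dualNorm_add`), and suprema
over `u` and `w` conclude.

The sets come from testing disjointness against a single functional `∫ · v dμ` with `v > 0` a.e.
(`exists_pos_conj`) and from Borel–Cantelli. -/

/-! ### Measurability, the modular and the Luxemburg norm -/

/-- Monotonicity and lower semicontinuity make `Φ(t,·)` left-continuous. This reduces joint
measurability to countably many sections `Φ(·,q)`. -/
theorem MOFun.eq_iSup_nnrat (Φ : MOFun μ) : ∀ᵐ t ∂μ, ∀ x : ℝ≥0,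
    Φ.toFun t x = ⨆ q : ℚ≥0, if ((q : ℝ≥0) : ℝ≥0∞) ≤ x then Φ.toFun t (q : ℝ≥0) else 0 := by
  filter_upwards [Φ.mono, Φ.lsc, Φ.map_zero] with t hm hl h0 x
  refine le_antisymm ?_ (iSup_le fun q => ?_)
  · refine le_of_forall_lt fun a ha => ?_
    rcases eq_or_ne x 0 with rfl | hx
    · simp [h0] at ha
    have hx' : 0 < (x : ℝ≥0∞) := by simpa [pos_iff_ne_zero] using hx
    have hev := hl (x : ℝ≥0∞) a ha
    obtain ⟨l, hlx, hl'⟩ := exists_Ioc_subset_of_mem_nhds hev ⟨0, hx'⟩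
    obtain ⟨q, hq0, hq1, hq2⟩ := ENNReal.lt_iff_exists_rat_btwn.1 hlx
    lift q to ℚ≥0 using hq0
    have e : Real.toNNReal ((q : ℚ) : ℝ) = (q : ℝ≥0) := by
      have : ((q : ℚ) : ℝ) = ((q : ℝ≥0) : ℝ) := by
        rw [Rat.cast_nnratCast]
        rfl
      rw [this, Real.toNNReal_coe]
    rw [e] at hq1 hq2
    have : a < Φ.toFun t (q : ℝ≥0) := hl' ⟨hq1, hq2.le⟩
    refine this.trans_le ?_
    refine le_trans ?_ (le_iSup _ q)
    rw [if_pos hq2.le]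
  · split_ifs with h
    · exact hm h
    · exact zero_le

theorem MOFun.aemeasurable_comp (Φ : MOFun μ) (u : T →ₘ[μ] ℝ) :
    AEMeasurable (fun t => Φ.toFun t ‖u t‖ₑ) μ := by
  refine ⟨fun t => ⨆ q : ℚ≥0, if ((q : ℝ≥0) : ℝ≥0∞) ≤ ‖u t‖ₑ then Φ.toFun t (q : ℝ≥0) else 0,
    ?_, ?_⟩
  · refine Measurable.iSup fun q => Measurable.ite ?_ (Φ.measurable _) measurable_const
    exact measurableSet_le measurable_const u.measurable.enorm
  · filter_upwards [Φ.eq_iSup_nnrat] with t ht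
    exact ht ‖u t‖₊

theorem MOFun.modular_mono (Φ : MOFun μ) {w u : T →ₘ[μ] ℝ} (h : ∀ᵐ t ∂μ, |w t| ≤ |u t|) :
    modular Φ.toFun w ≤ modular Φ.toFun u := by
  refine lintegral_mono_ae ?_
  filter_upwards [Φ.mono, h] with t hm ht
  exact hm (enorm_le_iff_norm_le.2 ht)

theorem ae_abs_smul_le {w u : T →ₘ[μ] ℝ} (h : ∀ᵐ t ∂μ, |w t| ≤ |u t|) (c : ℝ) :
    ∀ᵐ t ∂μ, |(c • w) t| ≤ |(c • u) t| := by
  filter_upwards [h, AEEqFun.coeFn_smul c w, AEEqFun.coeFn_smul c u] with t ht h1 h2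
  rw [h1, h2]
  simp only [Pi.smul_apply, smul_eq_mul, abs_mul]
  gcongr

theorem MOFun.mem_space_of_abs_le (Φ : MOFun μ) {w u : T →ₘ[μ] ℝ} (h : ∀ᵐ t ∂μ, |w t| ≤ |u t|)
    (hu : u ∈ space Φ) : w ∈ space Φ := by
  obtain ⟨c, hc, hlt⟩ := hu
  exact ⟨c, hc, (Φ.modular_mono (ae_abs_smul_le h c)).trans_lt hlt⟩

theorem MOFun.modular_smul_le (Φ : MOFun μ) (u : T →ₘ[μ] ℝ) {a : ℝ≥0} (ha : a ≤ 1) :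
    modular Φ.toFun ((a : ℝ) • u) ≤ a * modular Φ.toFun u := by
  unfold modular
  rw [← lintegral_const_mul' _ _ ENNReal.coe_ne_top]
  refine lintegral_mono_ae ?_
  filter_upwards [Φ.smul_le, AEEqFun.coeFn_smul (a : ℝ) u] with t hs h1
  rw [h1, Pi.smul_apply, enorm_smul]
  have : ‖(a : ℝ)‖ₑ = a := by simp [enorm_eq_nnnorm]
  rw [this]
  exact hs a _ ha

theorem MOFun.exists_modular_le_one (Φ : MOFun μ) {u : T →ₘ[μ] ℝ} (hu : u ∈ space Φ) :
    ∃ r : ℝ, 0 < r ∧ modular Φ.toFun (r⁻¹ • u) ≤ 1 := by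
  obtain ⟨c, hc, hlt⟩ := hu
  set M : ℝ≥0 := (modular Φ.toFun (c • u)).toNNReal with hM
  have hM' : modular Φ.toFun (c • u) = M := (ENNReal.coe_toNNReal hlt.ne).symm
  refine ⟨(M + 1) / c, by positivity, ?_⟩
  -- By convexity, scaling by `1 / (M + 1)` brings the modular from `M` to at most `M / (M + 1)`.
  have ha : (M + 1)⁻¹ ≤ 1 := inv_le_one_of_one_le₀ (by simp)
  have h := Φ.modular_smul_le (c • u) ha
  rw [hM', ← ENNReal.coe_mul, smul_smul] at h
  have e : ((M : ℝ) + 1) / c = ((((M + 1)⁻¹ : ℝ≥0) : ℝ) * c)⁻¹ := by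
    push_cast
    field_simp
  rw [e, inv_inv]
  refine h.trans ?_
  rw [← ENNReal.coe_one, ENNReal.coe_le_coe]
  exact inv_mul_le_one_of_le₀ (by simp) (by simp)

theorem luxNorm_nonneg (Φ : T → ℝ≥0∞ → ℝ≥0∞) (u : T →ₘ[μ] ℝ) : 0 ≤ luxNorm Φ u :=
  Real.sInf_nonneg fun _ hr => hr.1.le

theorem luxNorm_le {Φ : T → ℝ≥0∞ → ℝ≥0∞} {u : T →ₘ[μ] ℝ} {r : ℝ} (hr : 0 < r)
    (h : modular Φ (r⁻¹ • u) ≤ 1) : luxNorm Φ u ≤ r :=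
  csInf_le ⟨0, fun _ hr => hr.1.le⟩ ⟨hr, h⟩

theorem MOFun.le_mul_luxNorm (Φ : MOFun μ) {u : T →ₘ[μ] ℝ} (hu : u ∈ space Φ) {a C : ℝ}
    (hC : 0 ≤ C) (h : ∀ r, 0 < r → modular Φ.toFun (r⁻¹ • u) ≤ 1 → a ≤ C * r) :
    a ≤ C * luxNorm Φ.toFun u := by
  obtain ⟨r₀, hr₀, hm₀⟩ := Φ.exists_modular_le_one hu
  rcases hC.eq_or_lt with rfl | hC
  · simpa using h r₀ hr₀ hm₀
  rw [← div_le_iff₀' hC]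
  exact le_csInf ⟨r₀, hr₀, hm₀⟩ fun r hr => (div_le_iff₀' hC).2 (h r hr.1 hr.2)

theorem MOFun.luxNorm_mono (Φ : MOFun μ) {w u : T →ₘ[μ] ℝ} (h : ∀ᵐ t ∂μ, |w t| ≤ |u t|)
    (hu : u ∈ space Φ) : luxNorm Φ.toFun w ≤ luxNorm Φ.toFun u := by
  rw [← one_mul (luxNorm Φ.toFun u)]
  refine Φ.le_mul_luxNorm hu zero_le_one fun r hr hm => ?_
  rw [one_mul]
  exact luxNorm_le hr ((Φ.modular_mono (ae_abs_smul_le h _)).trans hm)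

/-! ### The dual norm and the modulus of a functional -/

variable {Φ : MOFun μ}

theorem dual_exists_bound (f : dual Φ) :
    ∃ C : ℝ, 0 ≤ C ∧ ∀ u : space Φ, |f.1 u| ≤ C * luxNorm Φ.toFun (u : T →ₘ[μ] ℝ) := by
  obtain ⟨C, hC⟩ := f.2
  exact ⟨max C 0, le_max_right _ _, fun u => (hC u).trans
    (mul_le_mul_of_nonneg_right (le_max_left _ _) (luxNorm_nonneg _ _))⟩

theorem dualNorm_nonneg (f : dual Φ) : 0 ≤ dualNorm f :=
  Real.iSup_nonneg fun _ => div_nonneg (abs_nonneg _) (luxNorm_nonneg _ _)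

theorem abs_le_dualNorm (f : dual Φ) {u : space Φ}
    (hu : modular Φ.toFun (u : T →ₘ[μ] ℝ) ≤ 1) : |f.1 u| ≤ dualNorm f := by
  obtain ⟨C, hC, h⟩ := dual_exists_bound f
  have h1 : luxNorm Φ.toFun (u : T →ₘ[μ] ℝ) ≤ 1 := luxNorm_le one_pos (by simpa using hu)
  have hb : BddAbove (Set.range fun u : space Φ =>
      |f.1 u| / luxNorm Φ.toFun (u : T →ₘ[μ] ℝ)) := by
    refine ⟨C, ?_⟩
    rintro _ ⟨u, rfl⟩
    exact div_le_of_le_mul₀ (luxNorm_nonneg _ _) hC (h u)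
  have h2 : |f.1 u| / luxNorm Φ.toFun (u : T →ₘ[μ] ℝ) ≤ dualNorm f := le_ciSup hb u
  -- If `‖u‖_Φ = 0`, boundedness of `f` forces `f u = 0`, so definiteness of the norm is not needed.
  rcases (luxNorm_nonneg Φ.toFun (u : T →ₘ[μ] ℝ)).eq_or_lt with h0 | h0
  · have := h u
    rw [← h0, mul_zero] at this
    exact this.trans (dualNorm_nonneg f)
  · rw [div_le_iff₀ h0] at h2
    exact h2.trans (mul_le_of_le_one_right (dualNorm_nonneg f) h1)

/-- A one-sided bound suffices because the modular is even. -/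
theorem dualNorm_le (f : dual Φ) {C : ℝ} (hC : 0 ≤ C)
    (h : ∀ u : space Φ, modular Φ.toFun (u : T →ₘ[μ] ℝ) ≤ 1 → f.1 u ≤ C) : dualNorm f ≤ C := by
  have habs : ∀ u : space Φ, modular Φ.toFun (u : T →ₘ[μ] ℝ) ≤ 1 → |f.1 u| ≤ C := by
    intro u hu
    refine abs_le'.2 ⟨h u hu, ?_⟩
    rw [← map_neg]
    refine h (-u) (le_trans (Φ.modular_mono ?_) hu)
    filter_upwards [AEEqFun.coeFn_neg (u : T →ₘ[μ] ℝ)] with t ht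
    simp [ht]
  refine Real.iSup_le (fun u => ?_) hC
  refine div_le_of_le_mul₀ (luxNorm_nonneg _ _) hC ?_
  refine Φ.le_mul_luxNorm u.2 hC fun r hr hm => ?_
  have := habs (r⁻¹ • u) hm
  rw [map_smul, smul_eq_mul, abs_mul, abs_of_pos (inv_pos.2 hr)] at this
  rwa [inv_mul_le_iff₀ hr, mul_comm] at this

theorem ae_abs_le_abs {w u : T →ₘ[μ] ℝ} (h : |w| ≤ u) : ∀ᵐ t ∂μ, |w t| ≤ |u t| := by
  filter_upwards [AEEqFun.coeFn_le.2 h, AEEqFun.coeFn_abs w] with t h1 h2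
  rw [h2] at h1
  exact h1.trans (le_abs_self _)

theorem modulus_nonneg (f : dual Φ) (u : space Φ) : 0 ≤ modulus f u :=
  Real.sSup_nonneg fun _ ⟨_, _, hr⟩ => hr ▸ abs_nonneg _

theorem abs_le_modulus (f : dual Φ) {w u : space Φ}
    (h : |(w : T →ₘ[μ] ℝ)| ≤ (u : T →ₘ[μ] ℝ)) : |f.1 w| ≤ modulus f u := by
  obtain ⟨C, hC, hb⟩ := dual_exists_bound f
  refine le_csSup ⟨C * luxNorm Φ.toFun (u : T →ₘ[μ] ℝ), ?_⟩ ⟨w, h, rfl⟩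
  rintro _ ⟨x, hx, rfl⟩
  exact (hb x).trans
    (mul_le_mul_of_nonneg_left (Φ.luxNorm_mono (ae_abs_le_abs hx) u.2) hC)

/-! ### Young's inequality and integral functionals -/

theorem young {T : Type*} (Φ : T → ℝ≥0∞ → ℝ≥0∞) (t : T) (x y : ℝ≥0∞) : x * y ≤ Φ t x + conj Φ t y := by
  rcases eq_or_ne x 0 with rfl | hx
  · simp
  · rw [← tsub_le_iff_left]
    exact le_iSup₂_of_le x (pos_iff_ne_zero.2 hx) le_rfl

theorem lintegral_enorm_mul_le (Φ : MOFun μ) (u v : T →ₘ[μ] ℝ) :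
    ∫⁻ t, ‖u t * v t‖ₑ ∂μ ≤ modular Φ.toFun u + modular (conj Φ.toFun) v := by
  unfold modular
  -- Additivity needs measurability of the `Φ` term only, not of the conjugate term.
  rw [← lintegral_add_left' (Φ.aemeasurable_comp u)]
  refine lintegral_mono fun t => ?_
  rw [enorm_mul]
  exact young _ _ _ _

theorem integrable_mul (Φ : MOFun μ) {u v : T →ₘ[μ] ℝ} (hu : u ∈ space Φ)
    (hv : MemMO (conj Φ.toFun) v) : Integrable (fun t => u t * v t) μ := by
  obtain ⟨c, hc, hcu⟩ := hu
  obtain ⟨d, hd, hdv⟩ := hv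
  have h : Integrable (fun t => (c • u) t * (d • v) t) μ :=
    ⟨((c • u).measurable.mul (d • v).measurable).aestronglyMeasurable,
      (lintegral_enorm_mul_le Φ _ _).trans_lt (ENNReal.add_lt_top.2 ⟨hcu, hdv⟩)⟩
  refine (h.const_mul (c * d)⁻¹).congr ?_
  filter_upwards [AEEqFun.coeFn_smul c u, AEEqFun.coeFn_smul d v] with t h1 h2
  rw [h1, h2]
  simp only [Pi.smul_apply, smul_eq_mul]
  field_simp

/-- The functional `u ↦ ∫ u v dμ` for a `v` with `I_{Φ*}(v) < ∞`. -/
noncomputable def integralDual (Φ : MOFun μ) (v : T →ₘ[μ] ℝ)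
    (hv : modular (conj Φ.toFun) v < ∞) : dual Φ := by
  have hv' : MemMO (conj Φ.toFun) v := ⟨1, one_pos, by simpa using hv⟩
  refine ⟨{ toFun := fun u => ∫ t, (u : T →ₘ[μ] ℝ) t * v t ∂μ, map_add' := ?_, map_smul' := ?_ },
    1 + (modular (conj Φ.toFun) v).toReal, fun u => ?_⟩
  · intro x y
    rw [← integral_add (integrable_mul Φ x.2 hv') (integrable_mul Φ y.2 hv')]
    refine integral_congr_ae ?_
    filter_upwards [AEEqFun.coeFn_add (x : T →ₘ[μ] ℝ) (y : T →ₘ[μ] ℝ)] with t ht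
    simp only [Submodule.coe_add, ht, Pi.add_apply, add_mul]
  · intro c x
    rw [RingHom.id_apply, smul_eq_mul, ← integral_const_mul]
    refine integral_congr_ae ?_
    filter_upwards [AEEqFun.coeFn_smul c (x : T →ₘ[μ] ℝ)] with t ht
    simp only [Submodule.coe_smul, ht, Pi.smul_apply, smul_eq_mul, mul_assoc]
  · refine Φ.le_mul_luxNorm u.2 (by positivity) fun r hr hm => ?_
    have h1 : ∫⁻ t, ‖(r⁻¹ • (u : T →ₘ[μ] ℝ)) t * v t‖ₑ ∂μ ≤
        1 + modular (conj Φ.toFun) v :=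
      (lintegral_enorm_mul_le Φ _ _).trans (by gcongr)
    have h2 : ∫ t, (r⁻¹ • (u : T →ₘ[μ] ℝ)) t * v t ∂μ =
        r⁻¹ * ∫ t, (u : T →ₘ[μ] ℝ) t * v t ∂μ := by
      rw [← integral_const_mul]
      refine integral_congr_ae ?_
      filter_upwards [AEEqFun.coeFn_smul r⁻¹ (u : T →ₘ[μ] ℝ)] with t ht
      simp only [ht, Pi.smul_apply, smul_eq_mul, mul_assoc]
    have h3 := (enorm_integral_le_lintegral_enorm
      (fun t => (r⁻¹ • (u : T →ₘ[μ] ℝ)) t * v t) (μ := μ)).trans h1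
    rw [h2] at h3
    have h4 := ENNReal.toReal_mono (by finiteness) h3
    rw [toReal_enorm, ENNReal.toReal_add (by simp) hv.ne, ENNReal.toReal_one, norm_mul, norm_inv,
      Real.norm_eq_abs, Real.norm_eq_abs, abs_of_pos hr, inv_mul_le_iff₀ hr, mul_comm] at h4
    exact h4

/-! ### Concentration of purely singular functionals -/

theorem MOFun.exists_one_le (Φ : MOFun μ) :
    ∀ᵐ t ∂μ, ∃ n : ℕ, 1 ≤ Φ.toFun t ((n + 1 : ℕ) : ℝ≥0) := by
  filter_upwards [Φ.lsc, Φ.map_top] with t hl ht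
  have hev : ∀ᶠ x in 𝓝 (∞ : ℝ≥0∞), 1 < Φ.toFun t x := hl ∞ 1 (by simp [ht])
  have h1 : Tendsto (fun n : ℕ => (((n + 1 : ℕ) : ℝ≥0) : ℝ≥0∞)) atTop (𝓝 ∞) := by
    simpa using (tendsto_add_atTop_iff_nat 1).2 ENNReal.tendsto_nat_nhds_top
  obtain ⟨n, hn⟩ := (h1.eventually hev).exists
  exact ⟨n, hn.le⟩

/-- For `x ≤ n` the left side is at most 1. For `x ≥ n`, convexity and `Φ(t,0) = 0` give `1 ≤ Φ(t,n)
≤ (n/x) Φ(t,x)`. -/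
theorem MOFun.mul_inv_le (Φ : MOFun μ) : ∀ᵐ t ∂μ, ∀ (n : ℝ≥0) (x : ℝ≥0∞), 0 < n →
    1 ≤ Φ.toFun t n → x * (n : ℝ≥0∞)⁻¹ ≤ 1 + Φ.toFun t x := by
  filter_upwards [Φ.smul_le, Φ.map_top] with t hs ht n x hn h1
  have hn0 : (n : ℝ≥0∞) ≠ 0 := by simpa using hn.ne'
  rcases le_total x n with hx | hx
  · refine le_add_right ?_
    rw [← div_eq_mul_inv]
    exact ENNReal.div_le_of_le_mul (by simpa using hx)
  refine le_add_left ?_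
  rcases eq_or_ne x ∞ with rfl | hxt
  · simp [ht]
  lift x to ℝ≥0 using hxt
  have hx' : n ≤ x := by exact_mod_cast hx
  have hx0 : 0 < x := hn.trans_le hx'
  have h2 := hs (n / x) x (div_le_one_of_le₀ hx' hx0.le)
  rw [← ENNReal.coe_mul, div_mul_cancel₀ _ hx0.ne'] at h2
  have h3 := h1.trans h2
  calc (x : ℝ≥0∞) * (n : ℝ≥0∞)⁻¹ = ((x / n : ℝ≥0) : ℝ≥0∞) * 1 := by
        rw [mul_one, ENNReal.coe_div hn.ne', div_eq_mul_inv]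
    _ ≤ ((x / n : ℝ≥0) : ℝ≥0∞) * (((n / x : ℝ≥0) : ℝ≥0∞) * Φ.toFun t x) := by gcongr
    _ = Φ.toFun t x := by
        rw [← mul_assoc, ← ENNReal.coe_mul, div_mul_div_cancel₀ hn.ne', div_self hx0.ne',
          ENNReal.coe_one, one_mul]

/-- With `g` positive and integrable, `l = min g 1` and `x a ≤ 1 + Φ(t,x)`, one gets `x l a ≤ g +
Φ(t,x)`, that is, `Φ*(t, l a) ≤ g`. -/
theorem exists_pos_conj [SigmaFinite μ] (Φ : MOFun μ) :
    ∃ v : T →ₘ[μ] ℝ, (∀ᵐ t ∂μ, 0 < v t) ∧ modular (conj Φ.toFun) v < ∞ := by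
  obtain ⟨g, hg0, hgm, hg⟩ := exists_pos_lintegral_lt_of_sigmaFinite μ one_ne_zero
  set l : T → ℝ≥0∞ := fun t => min (g t : ℝ≥0∞) 1
  have hlm : Measurable l := hgm.coe_nnreal_ennreal.min measurable_const
  -- A measurable choice of slope: the largest `1/(n+1)` with `Φ(t,n+1) ≥ 1`, positive a.e. by
  -- `MOFun.exists_one_le`.
  set a : T → ℝ≥0∞ := fun t => ⨆ n : ℕ,
    if 1 ≤ Φ.toFun t ((n + 1 : ℕ) : ℝ≥0) then (((n + 1 : ℕ) : ℝ≥0) : ℝ≥0∞)⁻¹ else 0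
  have ham : Measurable a := Measurable.iSup fun n =>
    Measurable.ite (measurableSet_le measurable_const (Φ.measurable _)) measurable_const
      measurable_const
  have ha1 : ∀ t, a t ≤ 1 := fun t => iSup_le fun n => by
    split_ifs
    · rw [ENNReal.inv_le_one]
      simp
    · exact zero_le
  have hfin : ∀ t, l t * a t ≠ ∞ := fun t =>
    ENNReal.mul_ne_top (ne_top_of_le_ne_top ENNReal.one_ne_top (min_le_right _ _))
      (ne_top_of_le_ne_top ENNReal.one_ne_top (ha1 t))
  have hvm : Measurable fun t => (l t * a t).toReal := (hlm.mul ham).ennreal_toReal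
  set v : T →ₘ[μ] ℝ := AEEqFun.mk _ hvm.aestronglyMeasurable
  have hv : v =ᵐ[μ] fun t => (l t * a t).toReal := AEEqFun.coeFn_mk _ _
  refine ⟨v, ?_, ?_⟩
  · filter_upwards [hv, Φ.exists_one_le] with t ht ⟨n, hn⟩
    rw [ht]
    refine ENNReal.toReal_pos (mul_ne_zero ?_ ?_) (hfin t)
    · exact (lt_min (by exact_mod_cast hg0 t) one_pos).ne'
    · refine (lt_of_lt_of_le ?_ (le_iSup _ n)).ne'
      rw [if_pos hn]
      exact ENNReal.inv_pos.2 ENNReal.coe_ne_top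
  · refine lt_of_le_of_lt (lintegral_mono_ae ?_) (hg.trans ENNReal.one_lt_top)
    filter_upwards [hv, Φ.mul_inv_le] with t ht hΦ
    have e : ‖v t‖ₑ = l t * a t := by
      rw [ht, Real.enorm_of_nonneg ENNReal.toReal_nonneg, ENNReal.ofReal_toReal (hfin t)]
    rw [e]
    refine iSup₂_le fun x _ => tsub_le_iff_right.2 ?_
    have hx : x * a t ≤ 1 + Φ.toFun t x := by
      rw [ENNReal.mul_iSup]
      refine iSup_le fun n => ?_
      split_ifs with h
      · exact hΦ _ x (by positivity) h
      · simp
    calc x * (l t * a t) = l t * (x * a t) := by ring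
      _ ≤ l t * (1 + Φ.toFun t x) := by gcongr
      _ = l t + l t * Φ.toFun t x := by rw [mul_add, mul_one]
      _ ≤ g t + 1 * Φ.toFun t x := by
        gcongr
        · exact min_le_left _ _
        · exact min_le_right _ _
      _ = g t + Φ.toFun t x := by rw [one_mul]

/-- A purely singular functional is, below a given `z ≥ 0`, asymptotically concentrated on sets
`E n` that shrink to a subset of `{z = 0}`. -/
theorem IsPurelySingular.exists_sets [SigmaFinite μ] {f : dual Φ} (hf : IsPurelySingular f)
    (z : space Φ) (hz : 0 ≤ (z : T →ₘ[μ] ℝ)) :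
    ∃ E : ℕ → Set T, (∀ n, MeasurableSet (E n)) ∧
      (∀ᵐ t ∂μ, (z : T →ₘ[μ] ℝ) t ≠ 0 → ∀ᶠ n in atTop, t ∉ E n) ∧
      ∀ (n : ℕ) (y : space Φ), (∀ᵐ t ∂μ, |(y : T →ₘ[μ] ℝ) t| ≤ (z : T →ₘ[μ] ℝ) t) →
        (∀ᵐ t ∂μ, t ∈ E n → (y : T →ₘ[μ] ℝ) t = 0) → |f.1 y| ≤ 2 * (1 / 2) ^ n := by
  obtain ⟨v, hv0, hv⟩ := exists_pos_conj Φ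
  have hv' : MemMO (conj Φ.toFun) v := ⟨1, one_pos, by simpa using hv⟩
  have hd := hf (integralDual Φ v hv) ⟨v, hv', fun _ => rfl⟩ z hz
  have hw : ∀ n : ℕ, ∃ w : space Φ, 0 ≤ (w : T →ₘ[μ] ℝ) ∧
      (w : T →ₘ[μ] ℝ) ≤ (z : T →ₘ[μ] ℝ) ∧
      modulus f w + modulus (integralDual Φ v hv) (z - w) < (1 / 2) ^ n := by
    intro n
    obtain ⟨_, ⟨w, h0, h1, rfl⟩, hlt⟩ := exists_lt_of_csInf_lt
      (s := {r : ℝ | ∃ w : space Φ, 0 ≤ (w : T →ₘ[μ] ℝ) ∧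
        (w : T →ₘ[μ] ℝ) ≤ (z : T →ₘ[μ] ℝ) ∧
        r = modulus f w + modulus (integralDual Φ v hv) (z - w)})
      ⟨_, 0, le_rfl, hz, rfl⟩ (b := (1 / 2) ^ n) (by rw [hd]; positivity)
    exact ⟨w, h0, h1, hlt⟩
  choose w hw0 hwz hwlt using hw
  -- On `E n`, `z < 2 (z - w n)`, so `∫ z v` over `E n` is small; off `E n`, `z ≤ 2 w n`, so `f` is
  -- small there.
  refine ⟨fun n => {t | 2 * (w n : T →ₘ[μ] ℝ) t < (z : T →ₘ[μ] ℝ) t}, fun n => ?_, ?_, ?_⟩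
  · exact measurableSet_lt ((AEEqFun.measurable _).const_mul 2) (AEEqFun.measurable _)
  · set ρ : T → ℝ≥0∞ := fun t => ENNReal.ofReal ((z : T →ₘ[μ] ℝ) t * v t)
    have hρ : Measurable ρ :=
      ((AEEqFun.measurable _).mul (AEEqFun.measurable _)).ennreal_ofReal
    have hle : ∀ n : ℕ, μ.withDensity ρ {t | 2 * (w n : T →ₘ[μ] ℝ) t < (z : T →ₘ[μ] ℝ) t} ≤
        2 * (2⁻¹ : ℝ≥0∞) ^ n := by
      intro n
      have hm : MeasurableSet {t | 2 * (w n : T →ₘ[μ] ℝ) t < (z : T →ₘ[μ] ℝ) t} :=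
        measurableSet_lt ((AEEqFun.measurable _).const_mul 2) (AEEqFun.measurable _)
      have hint := integrable_mul Φ (z - w n).2 hv'
      have hsub : ((z - w n : space Φ) : T →ₘ[μ] ℝ) =ᵐ[μ]
          (z : T →ₘ[μ] ℝ) - (w n : T →ₘ[μ] ℝ) := AEEqFun.coeFn_sub _ _
      have hzw : 0 ≤ ((z - w n : space Φ) : T →ₘ[μ] ℝ) := by
        rw [← AEEqFun.coeFn_le]
        filter_upwards [hsub, AEEqFun.coeFn_le.2 (hwz n),
          AEEqFun.coeFn_zero (α := T) (β := ℝ) (μ := μ)] with t h1 h2 h3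
        rw [h1, h3]
        exact sub_nonneg.2 h2
      rw [withDensity_apply _ hm]
      calc ∫⁻ t in {t | 2 * (w n : T →ₘ[μ] ℝ) t < (z : T →ₘ[μ] ℝ) t}, ρ t ∂μ
          ≤ ∫⁻ t in {t | 2 * (w n : T →ₘ[μ] ℝ) t < (z : T →ₘ[μ] ℝ) t},
              2 * ENNReal.ofReal (((z - w n : space Φ) : T →ₘ[μ] ℝ) t * v t) ∂μ := by
            refine lintegral_mono_ae ?_
            filter_upwards [ae_restrict_mem hm, ae_restrict_of_ae hsub,
              ae_restrict_of_ae hv0] with t h1 h2 h3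
            rw [← ENNReal.ofReal_ofNat 2, ← ENNReal.ofReal_mul (by norm_num)]
            refine ENNReal.ofReal_le_ofReal ?_
            rw [h2, ← mul_assoc]
            replace h1 : 2 * (w n : T →ₘ[μ] ℝ) t < (z : T →ₘ[μ] ℝ) t := h1
            refine mul_le_mul_of_nonneg_right ?_ h3.le
            simp only [Pi.sub_apply]
            linarith
        _ ≤ ∫⁻ t, 2 * ENNReal.ofReal (((z - w n : space Φ) : T →ₘ[μ] ℝ) t * v t) ∂μ :=
            setLIntegral_le_lintegral _ _
        _ = 2 * ENNReal.ofReal (∫ t, ((z - w n : space Φ) : T →ₘ[μ] ℝ) t * v t ∂μ) := by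
            rw [lintegral_const_mul' _ _ (by simp), ofReal_integral_eq_lintegral_ofReal hint]
            filter_upwards [hv0, AEEqFun.coeFn_le.2 hzw,
              AEEqFun.coeFn_zero (α := T) (β := ℝ) (μ := μ)] with t h1 h2 h3
            rw [h3] at h2
            exact mul_nonneg h2 h1.le
        _ ≤ 2 * ENNReal.ofReal ((1 / 2) ^ n) := by
            gcongr
            have h1 : |(z - w n : space Φ).1| ≤ (z - w n : space Φ).1 := by
              rw [← AEEqFun.coeFn_le]
              filter_upwards [AEEqFun.coeFn_abs (z - w n : space Φ).1, AEEqFun.coeFn_le.2 hzw,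
                AEEqFun.coeFn_zero (α := T) (β := ℝ) (μ := μ)] with t h1 h2 h3
              rw [h3] at h2
              rw [h1, abs_of_nonneg h2]
            have h2 := (le_abs_self _).trans (abs_le_modulus (integralDual Φ v hv) h1)
            have h3 := modulus_nonneg f (w n)
            have h4 := hwlt n
            exact h2.trans (by linarith)
        _ = 2 * (2⁻¹ : ℝ≥0∞) ^ n := by
            rw [ENNReal.ofReal_pow (by norm_num), one_div, ENNReal.ofReal_inv_of_pos (by norm_num),
              ENNReal.ofReal_ofNat]
    have hsum : ∑' n : ℕ, μ.withDensity ρ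
        {t | 2 * (w n : T →ₘ[μ] ℝ) t < (z : T →ₘ[μ] ℝ) t} ≠ ∞ := by
      refine ne_top_of_le_ne_top ?_ (ENNReal.tsum_le_tsum hle)
      rw [ENNReal.tsum_mul_left, ENNReal.tsum_geometric]
      simp [ENNReal.mul_eq_top]
    -- Borel–Cantelli for the measure `z v dμ`; as `v > 0` a.e., its null sets are `μ`-null inside
    -- `{z ≠ 0}`.
    have hae := (ae_withDensity_iff hρ).1 (ae_eventually_notMem hsum)
    filter_upwards [hae, hv0, AEEqFun.coeFn_le.2 hz,
      AEEqFun.coeFn_zero (α := T) (β := ℝ) (μ := μ)] with t h1 h2 h3 h4 h5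
    refine h1 ?_
    rw [h4] at h3
    exact (ENNReal.ofReal_pos.2 (mul_pos (lt_of_le_of_ne h3 h5.symm) h2)).ne'
  · intro n y hyz hy0
    have h1 : |(((1 / 2 : ℝ) • y : space Φ) : T →ₘ[μ] ℝ)| ≤ (w n : T →ₘ[μ] ℝ) := by
      rw [← AEEqFun.coeFn_le]
      filter_upwards [hyz, hy0, AEEqFun.coeFn_abs (((1 / 2 : ℝ) • y : space Φ) : T →ₘ[μ] ℝ),
        AEEqFun.coeFn_smul (1 / 2 : ℝ) (y : T →ₘ[μ] ℝ), AEEqFun.coeFn_le.2 (hw0 n),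
        AEEqFun.coeFn_zero (α := T) (β := ℝ) (μ := μ)] with t h1 h2 h3 h4 h5 h6
      rw [h3, Submodule.coe_smul, h4, Pi.smul_apply, smul_eq_mul, abs_mul]
      rw [h6] at h5
      rw [abs_of_pos (by norm_num : (0 : ℝ) < 1 / 2)]
      by_cases hE : 2 * (w n : T →ₘ[μ] ℝ) t < (z : T →ₘ[μ] ℝ) t
      · rw [h2 hE]
        simpa using h5
      · linarith [not_lt.1 hE]
    have h2 := abs_le_modulus f h1
    rw [map_smul, smul_eq_mul, abs_mul, abs_of_pos (by norm_num : (0 : ℝ) < 1 / 2)] at h2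
    have h3 := modulus_nonneg (integralDual Φ v hv) (z - w n)
    linarith [hwlt n]

/-! ### Restriction and gluing -/

/-- The restriction `u 1_A`, as an element of `L^Φ`. -/
noncomputable def restrict (A : Set T) (hA : MeasurableSet A) (u : space Φ) : space Φ :=
  ⟨AEEqFun.mk (A.indicator (u : T →ₘ[μ] ℝ))
      (((u : T →ₘ[μ] ℝ).measurable.indicator hA).aestronglyMeasurable), by
    refine Φ.mem_space_of_abs_le ?_ u.2
    filter_upwards [AEEqFun.coeFn_mk (μ := μ) (A.indicator (u : T →ₘ[μ] ℝ))
      (((u : T →ₘ[μ] ℝ).measurable.indicator hA).aestronglyMeasurable)] with t ht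
    rw [ht]
    by_cases h : t ∈ A <;> simp [h]⟩

theorem coeFn_restrict (A : Set T) (hA : MeasurableSet A) (u : space Φ) :
    (restrict A hA u : T →ₘ[μ] ℝ) =ᵐ[μ] A.indicator (u : T →ₘ[μ] ℝ) :=
  AEEqFun.coeFn_mk _ _

theorem restrict_add_restrict_compl (A : Set T) (hA : MeasurableSet A) (u : space Φ) :
    restrict A hA u + restrict Aᶜ hA.compl u = u := by
  refine Subtype.ext (AEEqFun.ext ?_)
  rw [Submodule.coe_add]
  filter_upwards [AEEqFun.coeFn_add (restrict A hA u : T →ₘ[μ] ℝ) (restrict Aᶜ hA.compl u),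
    coeFn_restrict A hA u, coeFn_restrict Aᶜ hA.compl u] with t h1 h2 h3
  rw [h1, Pi.add_apply, h2, h3, Set.indicator_self_add_compl_apply]

theorem modular_glue_le (A : Set T) (hA : MeasurableSet A) (u w : space Φ) :
    modular Φ.toFun ((restrict Aᶜ hA.compl u + restrict A hA w : space Φ) : T →ₘ[μ] ℝ) ≤
      modular Φ.toFun (u : T →ₘ[μ] ℝ) + ∫⁻ t in A, Φ.toFun t ‖(w : T →ₘ[μ] ℝ) t‖ₑ ∂μ := by
  have h : ((restrict Aᶜ hA.compl u + restrict A hA w : space Φ) : T →ₘ[μ] ℝ) =ᵐ[μ]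
      fun t => Aᶜ.indicator (u : T →ₘ[μ] ℝ) t + A.indicator (w : T →ₘ[μ] ℝ) t := by
    rw [Submodule.coe_add]
    filter_upwards [AEEqFun.coeFn_add (restrict Aᶜ hA.compl u : T →ₘ[μ] ℝ) (restrict A hA w),
      coeFn_restrict A hA w, coeFn_restrict Aᶜ hA.compl u] with t h1 h2 h3
    rw [h1, Pi.add_apply, h2, h3]
  unfold modular
  rw [← lintegral_add_compl _ hA, add_comm]
  refine add_le_add (le_trans (lintegral_mono_ae ?_) (setLIntegral_le_lintegral Aᶜ _))
    (lintegral_mono_ae ?_)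
  · filter_upwards [ae_restrict_of_ae h, ae_restrict_mem hA.compl] with t h1 h2
    rw [h1, Set.indicator_of_mem h2, Set.indicator_of_notMem h2, add_zero]
  · filter_upwards [ae_restrict_of_ae h, ae_restrict_mem hA] with t h1 h2
    rw [h1, Set.indicator_of_mem h2, Set.indicator_of_notMem (by simpa using h2), zero_add]

theorem tendsto_modular_restrict (w : space Φ) (hw : modular Φ.toFun (w : T →ₘ[μ] ℝ) < ∞)
    {E : ℕ → Set T} (hE : ∀ n, MeasurableSet (E n))
    (hlim : ∀ᵐ t ∂μ, (w : T →ₘ[μ] ℝ) t ≠ 0 → ∀ᶠ n in atTop, t ∉ E n) :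
    Tendsto (fun n => ∫⁻ t in E n, Φ.toFun t ‖(w : T →ₘ[μ] ℝ) t‖ₑ ∂μ) atTop (𝓝 0) := by
  simp_rw [← lintegral_indicator (hE _)]
  rw [← lintegral_zero (μ := μ)]
  refine tendsto_lintegral_of_dominated_convergence' (fun t => Φ.toFun t ‖(w : T →ₘ[μ] ℝ) t‖ₑ)
    (fun n => (Φ.aemeasurable_comp _).indicator (hE n))
    (fun n => Eventually.of_forall fun t => Set.indicator_le_self _ _ t) hw.ne ?_
  filter_upwards [hlim, Φ.map_zero] with t ht h0
  refine tendsto_const_nhds.congr' ?_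
  -- Where `w` vanishes, `Φ(t,0) = 0` makes the integrand zero whether or not `t ∈ E n`.
  by_cases hwt : (w : T →ₘ[μ] ℝ) t = 0
  · exact Eventually.of_forall fun n => by simp [Set.indicator, hwt, h0]
  · filter_upwards [ht hwt] with n hn
    rw [Set.indicator_of_notMem hn]

/-- Dominated convergence with majorant `|u v|`, integrable by Young's inequality. -/
theorem IsOrderContinuous.tendsto_restrict {f : dual Φ} (hf : IsOrderContinuous f) (u : space Φ)
    {E : ℕ → Set T} (hE : ∀ n, MeasurableSet (E n))
    (hlim : ∀ᵐ t ∂μ, (u : T →ₘ[μ] ℝ) t ≠ 0 → ∀ᶠ n in atTop, t ∉ E n) :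
    Tendsto (fun n => f.1 (restrict (E n) (hE n) u)) atTop (𝓝 0) := by
  obtain ⟨v, hv, hfv⟩ := hf
  simp_rw [hfv]
  rw [← integral_zero T ℝ (μ := μ)]
  refine tendsto_integral_of_dominated_convergence (fun t => ‖(u : T →ₘ[μ] ℝ) t * v t‖)
    (fun n => ((AEEqFun.measurable _).mul (AEEqFun.measurable _)).aestronglyMeasurable)
    (integrable_mul Φ u.2 hv).norm (fun n => ?_) ?_
  · filter_upwards [coeFn_restrict (E n) (hE n) u] with t ht
    rw [ht, norm_mul, norm_mul]
    gcongr
    exact norm_indicator_le_norm_self _ _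
  · filter_upwards [hlim, ae_all_iff.2 fun n => coeFn_restrict (E n) (hE n) u] with t ht h1
    refine tendsto_const_nhds.congr' ?_
    by_cases hut : (u : T →ₘ[μ] ℝ) t = 0
    · exact Eventually.of_forall fun n => by simp [h1, Set.indicator, hut]
    · filter_upwards [ht hut] with n hn
      rw [h1, Set.indicator_of_notMem hn, zero_mul]

/-! ### The lower bound for the norm of the sum -/

theorem add_le_dualNorm_add [SigmaFinite μ] {fc fs : dual Φ} (hc : IsOrderContinuous fc)
    (hs : IsPurelySingular fs) {u w : space Φ} (hu : modular Φ.toFun (u : T →ₘ[μ] ℝ) < 1)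
    (hw : modular Φ.toFun (w : T →ₘ[μ] ℝ) < ∞) : fc.1 u + fs.1 w ≤ dualNorm (fc + fs) := by
  have habs : ∀ x : space Φ, |(x : T →ₘ[μ] ℝ)| ∈ space Φ := fun x =>
    Φ.mem_space_of_abs_le (by
      filter_upwards [AEEqFun.coeFn_abs (x : T →ₘ[μ] ℝ)] with t ht
      rw [ht, abs_abs]) x.2
  -- A common majorant of `|u|` and `|w|`, so that one sequence of sets serves both.
  let z : space Φ := ⟨|(u : T →ₘ[μ] ℝ)|, habs u⟩ + ⟨|(w : T →ₘ[μ] ℝ)|, habs w⟩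
  have hz : (z : T →ₘ[μ] ℝ) =ᵐ[μ] fun t => |(u : T →ₘ[μ] ℝ) t| + |(w : T →ₘ[μ] ℝ) t| := by
    filter_upwards [AEEqFun.coeFn_add |(u : T →ₘ[μ] ℝ)| |(w : T →ₘ[μ] ℝ)|,
      AEEqFun.coeFn_abs (u : T →ₘ[μ] ℝ), AEEqFun.coeFn_abs (w : T →ₘ[μ] ℝ)] with t h1 h2 h3
    rw [← h2, ← h3]
    exact h1
  have hz0 : 0 ≤ (z : T →ₘ[μ] ℝ) := by
    rw [← AEEqFun.coeFn_le]
    filter_upwards [hz, AEEqFun.coeFn_zero (α := T) (β := ℝ) (μ := μ)] with t h1 h2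
    rw [h1, h2]
    exact add_nonneg (abs_nonneg _) (abs_nonneg _)
  obtain ⟨E, hE, hlim, hconc⟩ := hs.exists_sets z hz0
  have key : ∀ x : space Φ, (∀ᵐ t ∂μ, |(x : T →ₘ[μ] ℝ) t| ≤ (z : T →ₘ[μ] ℝ) t) →
      (∀ᵐ t ∂μ, (x : T →ₘ[μ] ℝ) t ≠ 0 → ∀ᶠ n in atTop, t ∉ E n) ∧
      Tendsto (fun n => fs.1 (restrict (E n)ᶜ (hE n).compl x)) atTop (𝓝 0) := by
    intro x hx
    constructor
    · filter_upwards [hlim, hx] with t h1 h2 h3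
      exact h1 ((abs_pos.2 h3).trans_le h2).ne'
    · refine squeeze_zero_norm (fun n => hconc n _ ?_ ?_) ?_
      · filter_upwards [coeFn_restrict (E n)ᶜ (hE n).compl x, hx] with t h1 h2
        rw [h1]
        exact le_trans (norm_indicator_le_norm_self (x : T →ₘ[μ] ℝ) t) h2
      · filter_upwards [coeFn_restrict (E n)ᶜ (hE n).compl x] with t h1 h2
        rw [h1, Set.indicator_of_notMem (by simpa using h2)]
      · simpa using (tendsto_pow_atTop_nhds_zero_of_lt_one (r := (1 / 2 : ℝ)) (by norm_num)
          (by norm_num)).const_mul 2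
  obtain ⟨hulim, hus⟩ := key u (by
    filter_upwards [hz] with t ht
    rw [ht]
    exact le_add_of_nonneg_right (abs_nonneg _))
  obtain ⟨hwlim, hws⟩ := key w (by
    filter_upwards [hz] with t ht
    rw [ht]
    exact le_add_of_nonneg_left (abs_nonneg _))
  have huc := hc.tendsto_restrict u hE hulim
  have hwc := hc.tendsto_restrict w hE hwlim
  have hval : ∀ n, (fc + fs).1 (restrict (E n)ᶜ (hE n).compl u + restrict (E n) (hE n) w) =
      fc.1 u + fs.1 w - fc.1 (restrict (E n) (hE n) u) + fc.1 (restrict (E n) (hE n) w) +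
        fs.1 (restrict (E n)ᶜ (hE n).compl u) - fs.1 (restrict (E n)ᶜ (hE n).compl w) := by
    intro n
    have h1 := congrArg fc.1 (restrict_add_restrict_compl (E n) (hE n) u)
    have h2 := congrArg fs.1 (restrict_add_restrict_compl (E n) (hE n) w)
    rw [map_add] at h1 h2
    rw [← h1, ← h2, Submodule.coe_add, LinearMap.add_apply, map_add, map_add]
    ring
  have hT : Tendsto (fun n => (fc + fs).1
      (restrict (E n)ᶜ (hE n).compl u + restrict (E n) (hE n) w)) atTop
      (𝓝 (fc.1 u + fs.1 w)) := by
    simp_rw [hval]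
    simpa using (((huc.const_sub (fc.1 u + fs.1 w)).add hwc).add hus).sub hws
  refine le_of_tendsto hT ?_
  -- The strict inequality `I_Φ(u) < 1` leaves room for the vanishing modular of `w` on `E n`.
  filter_upwards [(tendsto_modular_restrict w hw hE hwlim).eventually_le_const
    (tsub_pos_of_lt hu)] with n hn
  refine (le_abs_self _).trans (abs_le_dualNorm _ ((modular_glue_le _ (hE n) u w).trans ?_))
  calc _ ≤ modular Φ.toFun (u : T →ₘ[μ] ℝ) + (1 - modular Φ.toFun (u : T →ₘ[μ] ℝ)) := by gcongr
    _ = 1 := add_tsub_cancel_of_le hu.le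

theorem dualNorm_add_le (f g : dual Φ) : dualNorm (f + g) ≤ dualNorm f + dualNorm g :=
  dualNorm_le _ (add_nonneg (dualNorm_nonneg f) (dualNorm_nonneg g)) fun _ hu =>
    add_le_add ((le_abs_self _).trans (abs_le_dualNorm f hu))
      ((le_abs_self _).trans (abs_le_dualNorm g hu))

/-- Apply the strict case to `a u` with `a < 1`, whose modular is at most `a`, and let `a` tend to
1. -/
theorem add_le_dualNorm_add_of_le_one [SigmaFinite μ] {fc fs : dual Φ}
    (hc : IsOrderContinuous fc) (hs : IsPurelySingular fs) {u w : space Φ}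
    (hu : modular Φ.toFun (u : T →ₘ[μ] ℝ) ≤ 1) (hw : modular Φ.toFun (w : T →ₘ[μ] ℝ) < ∞) :
    fc.1 u + fs.1 w ≤ dualNorm (fc + fs) := by
  have hT : Tendsto (fun a : ℝ≥0 => (a : ℝ) * fc.1 u + fs.1 w) (𝓝[<] 1)
      (𝓝 (fc.1 u + fs.1 w)) := by
    have : Tendsto (fun a : ℝ≥0 => (a : ℝ) * fc.1 u + fs.1 w) (𝓝 1)
        (𝓝 (((1 : ℝ≥0) : ℝ) * fc.1 u + fs.1 w)) := Continuous.tendsto (by fun_prop) 1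
    rw [NNReal.coe_one, one_mul] at this
    exact this.mono_left nhdsWithin_le_nhds
  have : (𝓝[<] (1 : ℝ≥0)).NeBot := nhdsLT_neBot_of_exists_lt ⟨0, one_pos⟩
  refine le_of_tendsto hT ?_
  filter_upwards [self_mem_nhdsWithin] with a ha
  have h1 : modular Φ.toFun (((a : ℝ) • u : space Φ) : T →ₘ[μ] ℝ) < 1 := by
    refine (Φ.modular_smul_le (u : T →ₘ[μ] ℝ) (le_of_lt ha)).trans_lt ?_
    calc (a : ℝ≥0∞) * modular Φ.toFun (u : T →ₘ[μ] ℝ) ≤ a * 1 := by gcongr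
      _ < 1 := by rw [mul_one]; exact_mod_cast ha
  simpa using add_le_dualNorm_add hc hs h1 hw

end

end MusielakOrlicz

theorem mainTheorem9 {T : Type*} [MeasurableSpace T] (μ : MeasureTheory.Measure T)
    [MeasureTheory.SigmaFinite μ] (hμ : MusielakOrlicz.IsNonatomic μ)
    (Φ : MusielakOrlicz.MOFun μ) (f fc fs : MusielakOrlicz.dual Φ)
    (hf : MusielakOrlicz.IsDecomposition f fc fs) :
    MusielakOrlicz.dualNorm f = MusielakOrlicz.dualNorm fc + MusielakOrlicz.dualNorm fs := by
  rw [hf.eq_add]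
  refine le_antisymm (MusielakOrlicz.dualNorm_add_le _ _) ?_
  have h0 : MusielakOrlicz.modular Φ.toFun ((0 : MusielakOrlicz.space Φ) : T →ₘ[μ] ℝ) ≤ 1 := by
    have := Φ.modular_smul_le (0 : T →ₘ[μ] ℝ) zero_le_one
    simp at this
    simp [this]
  have hmain := fun {u w : MusielakOrlicz.space Φ} hu hw =>
    MusielakOrlicz.add_le_dualNorm_add_of_le_one hf.orderContinuous hf.singular (u := u) (w := w)
      hu hw
  -- The suprema over `u` and `w` are taken in turn; taking `u = 0` or `w = 0` gives the
  -- nonnegativity that `dualNorm_le` requires.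
  rw [← le_sub_iff_add_le]
  refine MusielakOrlicz.dualNorm_le fc ?_ fun u hu => ?_
  · rw [sub_nonneg]
    refine MusielakOrlicz.dualNorm_le fs (MusielakOrlicz.dualNorm_nonneg _) fun w hw => ?_
    simpa using hmain h0 (hw.trans_lt ENNReal.one_lt_top)
  · rw [le_sub_iff_add_le, ← le_sub_iff_add_le']
    refine MusielakOrlicz.dualNorm_le fs ?_ fun w hw => ?_
    · rw [sub_nonneg]
      simpa using hmain hu (h0.trans_lt ENNReal.one_lt_top)
    · rw [le_sub_iff_add_le']
      exact hmain hu (hw.trans_lt ENNReal.one_lt_top)
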